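/- There is a universal constant $C>0$ such that the following holds. Let $\mathcal X,\mathcal Y$ be measurable spaces (for instance subsets of $\mathbb R^d$ and of $\mathbb R$), let $Z=(X,Y)$ have an arbitrary distribution $\mathbb D$ on $\mathcal Z=\mathcal X\times\mathcal Y$, let $\mathcal H$ be a set of functions $\mathcal X\to\mathcal Y$, let $\ell:\mathcal Y\times\mathcal Y\to[0,\infty)$ be a loss (no Lipschitz continuity is assumed, so the square loss is allowed), and let $\mathcal F=\{(x,y)\mapsto \ell(h(x),y): h\in\mathcal H\}$ consist of measurable functions with $\mathrm E[f(Z)^2]\le\sigma^2$ for all $f\in\mathcal F$, where $\sigma>0$ is a constant. Let $(\phi_\alpha)_{\alpha>0}$ be truncation functions with constant $M>0$: for each $\alpha>0$, $\phi_\alpha:[0,\infty)\to[0,\infty)$ is continuously differentiable, $\phi_\alpha'(0)=1$, $\phi_\alpha'$ is non-increasing, $\phi_\alpha'(x)\to0$ as $x\to\infty$, $|\phi_\alpha(x)-x|\le Mx^2/\alpha$ for $x\ge0$, and $\phi_{\alpha_1}'\le\phi_{\alpha_2}'$ whenever $0<\alpha_1\le\alpha_2$. Put $\beta(\mathcal F,\alpha)=\sup_{f\in\mathcal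 F,\,z\in\mathcal Z}\phi_\alpha'(f(z))$. Write $P(f)=\mathrm E[f(Z)]$ and let $f^*\in\mathcal F$ minimize $P$ over $\mathcal F$. Let $n\ge1$, let $Z_1,\dots,Z_n$ be i.i.d. with distribution $\mathbb D$, and let $\widehat f=\widehat f_{Z_1,\dots,Z_n}$ minimize $\frac1n\sum_{i=1}^n\phi_\alpha(f(Z_i))$ over $f\in\mathcal F$; the estimator is measurable, i.e. $(z_1,\dots,z_n,z)\mapsto\widehat f_{z_1,\dots,z_n}(z)$ is measurable. Put $d_e(f,g)=(\mathrm E[(f(Z)-g(Z))^2])^{1/2}$ and $d_s(f,g)=(\frac1n\sum_{i=1}^n(f(Z_i)-g(Z_i))^2)^{1/2}$, and let $\Delta(A,d)$ be the diameter of $A$ with respect to $d$. Let $\gamma_2(\mathcal F,d)=\inf\sup_{f\in\mathcal F}\sum_{k\ge0}2^{k/2}\Delta(A_k(f),d)$, the infimum being over all increasing sequences (each refining the preceding one) of partitions $\mathcal A_0,\mathcal A_1,\dots$ of $\mathcal F$ with $\#\mathcal A_0=1$ and $\#\mathcal A_k\le2^{2^k}$ for $k\ge1$, and $A_k(f)$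 being the element of $\mathcal A_k$ that contains $f$. Then $\alpha\mapsto\beta(\mathcal F,\alpha)$ is non-decreasing on $(0,\infty)$ with values in $[0,1]$, and $\beta(\mathcal F,\alpha)>0$ unless $\phi_\alpha'(f(z))=0$ for all $f\in\mathcal F$ and $z\in\mathcal Z$; $\Delta(\mathcal F,d_e)<\infty$; and for every $\alpha>0$, every $\delta\in(0,1)$ and every $\Gamma_\delta\ge0$ with $\Pr(\gamma_2(\mathcal F,d_s)>\Gamma_\delta)\le\delta/8$, with probability at least $1-3\delta$, $$P(\widehat f)-P(f^*)\le C\,\beta(\mathcal F,\alpha)\,\max\bigl(\Gamma_\delta,\Delta(\mathcal F,d_e)\bigr)\sqrt{\frac{\log(8/\delta)}{n}}+\frac{2M\sigma^2}{\alpha}.$$ -/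

import Mathlib

open MeasureTheory Set Filter Topology
open scoped ENNReal NNReal

noncomputable section

namespace TruncatedRisk

/-! ### Generic chaining functionals -/

/-- The diameter `Δ(A, d)` of a set `A` with respect to a distance function `d`. -/
def diameter {T : Type*} (d : T → T → ℝ) (A : Set T) : ℝ≥0∞ :=
  ⨆ s ∈ A, ⨆ t ∈ A, ENNReal.ofReal (d s t)

/-- An admissible sequence of partitions of `T` (a partition is given by its equivalence relation):
the partitions are increasing (each one refines the preceding one), the first one is trivial, and
the `n`-th one has at most `2 ^ 2 ^ n` elements. -/
structure IsAdmissible {T : Type*} (A : ℕ → Setoid T) : Prop where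
  zero : A 0 = ⊤
  refines : ∀ n, A (n + 1) ≤ A n
  card_le : ∀ n, (A n).classes.encard ≤ 2 ^ 2 ^ n

/-- The functional `γ_b(T, d) = inf sup_t ∑_{n ≥ 0} 2^{n / b} Δ(A_n(t), d)`, where the infimum runs
over the admissible sequences of partitions and `A_n(t)` is the element of `A_n` containing `t`. -/
def gammaFunctional {T : Type*} (b : ℝ) (d : T → T → ℝ) : ℝ≥0∞ :=
  ⨅ (A : ℕ → Setoid T) (_ : IsAdmissible A),
    ⨆ t : T, ∑' n : ℕ, ENNReal.ofReal (2 ^ ((n : ℝ) / b)) * diameter d {s | A n s t}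

/-! ### Truncation functions -/

/-- The derivative of `φ` on `[0, ∞)` (one-sided at `0`). -/
def halfDeriv (φ : ℝ → ℝ) (x : ℝ) : ℝ := derivWithin φ (Ici 0) x

/-- `φ α : [0, ∞) → [0, ∞)`, `α > 0`, is a family of truncation functions with constant `M`.
As to smoothness, only continuous differentiability on `[0, ∞)` is asked for; it is implied both by
infinite differentiability and by the existence of a Lipschitz continuous derivative. -/
structure IsTruncation (φ : ℝ → ℝ → ℝ) (M : ℝ) : Prop where
  mapsTo : ∀ α, 0 < α → MapsTo (φ α) (Ici 0) (Ici 0)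
  contDiffOn : ∀ α, 0 < α → ContDiffOn ℝ 1 (φ α) (Ici 0)
  deriv_zero : ∀ α, 0 < α → halfDeriv (φ α) 0 = 1
  deriv_tendsto : ∀ α, 0 < α → Tendsto (halfDeriv (φ α)) atTop (𝓝 0)
  deriv_antitone : ∀ α, 0 < α → AntitoneOn (halfDeriv (φ α)) (Ici 0)
  const_pos : 0 < M
  abs_sub_le : ∀ α, 0 < α → ∀ x, 0 ≤ x → |φ α x - x| ≤ M * x ^ 2 / α
  deriv_mono : ∀ α₁ α₂, 0 < α₁ → α₁ ≤ α₂ → ∀ x, 0 ≤ x →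
    halfDeriv (φ α₁) x ≤ halfDeriv (φ α₂) x

/-! ### Loss classes, metrics and minimizers -/

/-- The class `{(X, Y) ↦ ℓ(h(X), Y) : h ∈ H}`. -/
def lossClass {𝒳 𝒴 : Type*} (ℓ : 𝒴 → 𝒴 → ℝ) (H : Set (𝒳 → 𝒴)) : Set (𝒳 × 𝒴 → ℝ) :=
  {f | ∃ h ∈ H, f = fun z => ℓ (h z.1) z.2}

/-- The empirical distance `d_s(f, g) = (n⁻¹ ∑ i, (f(Z_i) - g(Z_i))²)^{1/2}` for the sample `s`. -/
def empDist {𝒵 : Type*} {n : ℕ} (s : Fin n → 𝒵) (f g : 𝒵 → ℝ) : ℝ :=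
  √((1 / (n : ℝ)) * ∑ i, (f (s i) - g (s i)) ^ 2)

/-- The population distance `d_e(f, g) = (E (f(Z) - g(Z))²)^{1/2}`. -/
def popDist {𝒵 : Type*} [MeasurableSpace 𝒵] (P : Measure 𝒵) (f g : 𝒵 → ℝ) : ℝ :=
  √(∫ z, (f z - g z) ^ 2 ∂P)

/-- The expected risk `P(f) = E f(Z)`. -/
def risk {𝒵 : Type*} [MeasurableSpace 𝒵] (P : Measure 𝒵) (f : 𝒵 → ℝ) : ℝ := ∫ z, f z ∂P

/-- The empirical truncated risk `P_n(φ(f)) = n⁻¹ ∑ i, φ(f(Z_i))` for the sample `s`. -/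
def empTruncRisk {𝒵 : Type*} {n : ℕ} (φ : ℝ → ℝ) (s : Fin n → 𝒵) (f : 𝒵 → ℝ) : ℝ :=
  (1 / (n : ℝ)) * ∑ i, φ (f (s i))

/-- `β(F, α) = sup_{f ∈ F, z} φ_α'(f(z))`. -/
def truncSlope {𝒵 : Type*} (φ : ℝ → ℝ → ℝ) (F : Set (𝒵 → ℝ)) (α : ℝ) : ℝ :=
  sSup {r | ∃ f ∈ F, ∃ z, r = halfDeriv (φ α) (f z)}

end TruncatedRisk

end

open TruncatedRisk

/-! Truncation changes the risk of each function of the class by at most `M σ² / α`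
(`abs_integral_truncation_sub_le`), and the empirical truncated risk at the estimator is at most
that at `fstar`. It remains to bound the gap between the mean and the empirical mean of `φ α ∘ fhat
- φ α ∘ fstar`.

Since `φ α` is Lipschitz with constant `β` between values taken by the class (`abs_sub_le_mul`),
this difference has second moment at most `β² Δ²`. Chebyshev's inequality for a ghost sample then
compares the mean with a second empirical mean, and random exchange of the two samples gives
Rademacher sums (`measure_deviation_le`). The estimator depends on the exchange, so a bound uniform
over the class is needed. Generic chaining (`card_chaining_le`) gives one for each sample in its own
metric `empDist`, whose `γ₂` is controlled by `Γ` off a set of measure at most `δ / 8`.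

Probabilities over signs are counts of sign patterns. Only the deviation at the estimator is treated
as a random variable, so no supremum over the class has to be measurable. -/

/-- The Rademacher sum `∑ i, ± a i` for the pattern of signs `ε`. -/
def rademacherSum {n : ℕ} (a : Fin n → ℝ) (ε : Fin n → Bool) : ℝ :=
  ∑ i, cond (ε i) (a i) (-a i)

lemma rademacherSum_neg {n : ℕ} (a : Fin n → ℝ) (ε : Fin n → Bool) :
    rademacherSum (-a) ε = -rademacherSum a ε := by
  unfold rademacherSum
  rw [← Finset.sum_neg_distrib]
  refine Finset.sum_congr rfl fun i _ => ?_
  cases ε i <;> simp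

lemma rademacherSum_sub {n : ℕ} (a b : Fin n → ℝ) (ε : Fin n → Bool) :
    rademacherSum (fun i => a i - b i) ε = rademacherSum a ε - rademacherSum b ε := by
  unfold rademacherSum
  rw [← Finset.sum_sub_distrib]
  refine Finset.sum_congr rfl fun i _ => ?_
  cases ε i <;> simp; ring

lemma rademacherSum_const_mul {n : ℕ} (r : ℝ) (a : Fin n → ℝ) (ε : Fin n → Bool) :
    rademacherSum (fun i => r * a i) ε = r * rademacherSum a ε := by
  unfold rademacherSum
  rw [Finset.mul_sum]
  refine Finset.sum_congr rfl fun i _ => ?_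
  cases ε i <;> simp

/-- Cauchy–Schwarz. This bound, valid for every sign pattern, closes the chain at its last level. -/
lemma abs_rademacherSum_le {n : ℕ} (a : Fin n → ℝ) (ε : Fin n → Bool) {w : ℝ} (hw : 0 ≤ w)
    (h : ∑ i, a i ^ 2 ≤ w ^ 2) : |rademacherSum a ε| ≤ √n * w := by
  apply abs_le_of_sq_le_sq _ (by positivity)
  rw [mul_pow, Real.sq_sqrt (by positivity)]
  calc rademacherSum a ε ^ 2
      ≤ n * ∑ i, (cond (ε i) (a i) (-a i)) ^ 2 := by
        simpa [rademacherSum] using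
          sq_sum_le_card_mul_sum_sq (s := Finset.univ) (f := fun i => cond (ε i) (a i) (-a i))
    _ = n * ∑ i, a i ^ 2 := by
        congr 1
        refine Finset.sum_congr rfl fun i _ => ?_
        cases ε i <;> simp
    _ ≤ n * w ^ 2 := by gcongr

/-- The exponential moment factors over the coordinates, and `cosh x ≤ exp (x² / 2)`. -/
lemma sum_exp_rademacherSum_le {n : ℕ} (a : Fin n → ℝ) :
    ∑ ε, Real.exp (rademacherSum a ε) ≤ 2 ^ n * Real.exp ((∑ i, a i ^ 2) / 2) := by
  have h1 : ∑ ε, Real.exp (rademacherSum a ε) = ∏ i, ∑ b, Real.exp (cond b (a i) (-a i)) := by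
    rw [Finset.prod_univ_sum, Fintype.piFinset_univ]
    exact Finset.sum_congr rfl fun ε _ => Real.exp_sum _ _
  have h2 : (2 : ℝ) ^ n * Real.exp ((∑ i, a i ^ 2) / 2) = ∏ i, (2 * Real.exp (a i ^ 2 / 2)) := by
    rw [Finset.prod_mul_distrib, Finset.sum_div, Real.exp_sum]
    simp
  rw [h1, h2]
  refine Finset.prod_le_prod (fun i _ => by positivity) fun i _ => ?_
  have := Real.cosh_le_exp_half_sq (a i)
  rw [Real.cosh_eq] at this
  simp only [Fintype.sum_bool, cond_true, cond_false]
  linarith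

/-- Hoeffding's inequality for Rademacher sums. -/
lemma card_lt_rademacherSum_le {n : ℕ} (a : Fin n → ℝ) {v w : ℝ} (hw : 0 ≤ w)
    (hv : 0 ≤ v) (h : ∑ i, a i ^ 2 ≤ w ^ 2) :
    ((Finset.univ.filter fun ε => v * w < rademacherSum a ε).card : ℝ)
      ≤ 2 ^ n * Real.exp (-(v ^ 2 / 2)) := by
  rcases hw.eq_or_lt with rfl | hw
  · have : ∀ ε, ¬ v * 0 < rademacherSum a ε := fun ε hε => by
      have := abs_rademacherSum_le a ε le_rfl h
      have := le_abs_self (rademacherSum a ε)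
      linarith
    rw [Finset.filter_false_of_mem fun ε _ => this ε]
    simp only [Finset.card_empty, Nat.cast_zero]
    positivity
  -- Chernoff's method with the optimal parameter `v / w`: the event forces an exponent of at least
  -- `v²`, while the exponential moment costs only `v² / 2`.
  have h1 : ((Finset.univ.filter fun ε => v * w < rademacherSum a ε).card : ℝ) * Real.exp (v ^ 2)
      ≤ ∑ ε, Real.exp (rademacherSum (fun i => v / w * a i) ε) := by
    rw [← nsmul_eq_mul]
    refine (Finset.card_nsmul_le_sum _ _ _ fun ε hε => ?_).trans
      (Finset.sum_le_sum_of_subset_of_nonneg (Finset.subset_univ _)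
        fun _ _ _ => (Real.exp_pos _).le)
    rw [rademacherSum_const_mul]
    have := (Finset.mem_filter.1 hε).2
    apply Real.exp_le_exp.2
    calc v ^ 2 = v / w * (v * w) := by field_simp
      _ ≤ _ := by gcongr
  have h2 : ∑ i, (v / w * a i) ^ 2 ≤ v ^ 2 := by
    simp_rw [mul_pow]
    rw [← Finset.mul_sum]
    calc (v / w) ^ 2 * ∑ i, a i ^ 2 ≤ (v / w) ^ 2 * w ^ 2 := by gcongr
      _ = v ^ 2 := by field_simp
  have h3 := h1.trans (sum_exp_rademacherSum_le _)
  have h4 : Real.exp ((∑ i, (v / w * a i) ^ 2) / 2) ≤ Real.exp (v ^ 2 / 2) := by gcongr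
  have h5 : Real.exp (v ^ 2 / 2) = Real.exp (-(v ^ 2 / 2)) * Real.exp (v ^ 2) := by
    rw [← Real.exp_add]; congr 1; ring
  have h6 := h3.trans (mul_le_mul_of_nonneg_left h4 (by positivity))
  rw [h5, ← mul_assoc] at h6
  exact le_of_mul_le_mul_right h6 (Real.exp_pos _)

lemma card_lt_abs_rademacherSum_le {n : ℕ} (a : Fin n → ℝ) {v w : ℝ} (hw : 0 ≤ w)
    (hv : 0 ≤ v) (h : ∑ i, a i ^ 2 ≤ w ^ 2) :
    ((Finset.univ.filter fun ε => v * w < |rademacherSum a ε|).card : ℝ)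
      ≤ 2 * (2 ^ n * Real.exp (-(v ^ 2 / 2))) := by
  have h1 := card_lt_rademacherSum_le a hw hv h
  have h2 := card_lt_rademacherSum_le (-a) hw hv (by simpa using h)
  have h3 : (Finset.univ.filter fun ε => v * w < |rademacherSum a ε|) ⊆
      (Finset.univ.filter fun ε => v * w < rademacherSum a ε) ∪
      (Finset.univ.filter fun ε => v * w < rademacherSum (-a) ε) := by
    intro ε hε
    simpa [rademacherSum_neg, lt_abs] using hε
  have h4 := (Finset.card_le_card h3).trans (Finset.card_union_le _ _)
  have h5 : ((Finset.univ.filter fun ε => v * w < |rademacherSum a ε|).card : ℝ) ≤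
    (Finset.univ.filter fun ε => v * w < rademacherSum a ε).card +
      (Finset.univ.filter fun ε => v * w < rademacherSum (-a) ε).card := by exact_mod_cast h4
  linarith

/-! ### Generic chaining for Rademacher processes -/

lemma two_rpow_half (k : ℕ) : (2 : ℝ) ^ ((k : ℝ) / 2) = √2 ^ k := by
  rw [Real.sqrt_eq_rpow, ← Real.rpow_natCast, ← Real.rpow_mul (by norm_num)]
  congr 1; ring

lemma ofReal_le_diameter {T : Type*} (d : T → T → ℝ) {A : Set T} {s t : T} (hs : s ∈ A)
    (ht : t ∈ A) : ENNReal.ofReal (d s t) ≤ diameter d A :=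
  le_iSup₂_of_le s hs (le_iSup₂_of_le (f := fun t (_ : t ∈ A) => ENNReal.ofReal (d s t)) t ht le_rfl)

/-- A representative of the class of `t`. -/
noncomputable def classRep {T : Type*} (r : Setoid T) (t : T) : T := (Quotient.mk r t).out

lemma classRep_rel {T : Type*} (r : Setoid T) (t : T) : r (classRep r t) t :=
  Quotient.exact (Quotient.out_eq (Quotient.mk r t))

lemma classRep_eq {T : Type*} {r : Setoid T} {s t : T} (h : r s t) :
    classRep r s = classRep r t := by
  unfold classRep; rw [Quotient.sound h]

lemma TruncatedRisk.IsAdmissible.card_quotient_le {T : Type*} {A : ℕ → Setoid T} (hA : IsAdmissible A) (k : ℕ) :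
    Finite (Quotient (A k)) ∧ Nat.card (Quotient (A k)) ≤ 2 ^ 2 ^ k := by
  have h := hA.card_le k
  have hfin : (A k).classes.Finite := by
    apply Set.finite_of_encard_le_coe (k := 2 ^ 2 ^ k)
    simpa using h
  have e := Setoid.quotientEquivClasses (A k)
  have : Finite (A k).classes := hfin
  refine ⟨Finite.of_equiv _ e.symm, ?_⟩
  rw [Nat.card_congr e, Nat.card_coe_set_eq]
  rw [← hfin.cast_ncard_eq] at h
  exact_mod_cast h

/-- Two points of one cell are at distance at most its diameter. With suitable `x` and `y` this
controls both the links of the chain and the distance from `t` to its last approximation. -/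
lemma mul_diameter_sum_le {T : Type*} {A : ℕ → Setoid T} {d : T → T → ℝ}
    (hd : ∀ s t, 0 ≤ d s t) {G : ℝ} (hG : 0 ≤ G) {t : T}
    (h : ∑' k : ℕ, ENNReal.ofReal (2 ^ ((k : ℝ) / 2)) * diameter d {s | A k s t} ≤ ENNReal.ofReal G)
    (K : ℕ) (x y : ℕ → T) (hx : ∀ k, A k (x k) t) (hy : ∀ k, A k (y k) t) :
    ∑ k ∈ Finset.range K, √2 ^ k * d (x k) (y k) ≤ G := by
  rw [← ENNReal.ofReal_le_ofReal_iff hG, ENNReal.ofReal_sum_of_nonneg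
    (fun k _ => mul_nonneg (by positivity) (hd _ _))]
  refine le_trans ?_ ((ENNReal.sum_le_tsum (Finset.range K)).trans h)
  refine Finset.sum_le_sum fun k _ => ?_
  rw [ENNReal.ofReal_mul (by positivity), two_rpow_half]
  gcongr
  exact ofReal_le_diameter d (hx k) (hy k)

/-- Union bound over the links between levels `k` and `k + 1`: there are at most `2 ^ 2 ^ (k + 1)`
of them, and Hoeffding's tail at height `u √2 ^ (k + 1)` beats this number. -/
lemma card_link_le {T : Type*} {n : ℕ} {A : ℕ → Setoid T} (hA : IsAdmissible A) {d : T → T → ℝ}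
    (hd : ∀ s t, 0 ≤ d s t) {a : T → Fin n → ℝ} {c : ℝ} (hc : 0 ≤ c)
    (ha : ∀ s t, ∑ i, (a s i - a t i) ^ 2 ≤ (c * d s t) ^ 2) {p u : ℝ} (hp : 0 < p) (hp' : p ≤ 1 / 8)
    (hu : 0 ≤ u) (hup : u ^ 2 = -(4 * Real.log p)) (k : ℕ) (S : Finset (Fin n → Bool))
    (hS : ∀ ε ∈ S, ∃ t, u * √2 ^ (k + 1) * (c * d (classRep (A (k + 1)) t) (classRep (A k) t)) <
      |rademacherSum (a (classRep (A (k + 1)) t)) ε - rademacherSum (a (classRep (A k) t)) ε|) :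
    (S.card : ℝ) ≤ 2 * (1 / 8) ^ (k + 1) * p * 2 ^ n := by
  classical
  obtain ⟨hfin, hcard⟩ := hA.card_quotient_le (k + 1)
  have := Fintype.ofFinite (Quotient (A (k + 1)))
  rw [Nat.card_eq_fintype_card] at hcard
  set B : Quotient (A (k + 1)) → Finset (Fin n → Bool) := fun q =>
    Finset.univ.filter fun ε => u * √2 ^ (k + 1) * (c * d q.out (classRep (A k) q.out)) <
      |rademacherSum (fun i => a q.out i - a (classRep (A k) q.out) i) ε| with hB
  have hsub : S ⊆ Finset.univ.biUnion B := by
    intro ε hε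
    obtain ⟨t, ht⟩ := hS ε hε
    refine Finset.mem_biUnion.2 ⟨Quotient.mk _ t, Finset.mem_univ _, ?_⟩
    -- By refinement, the class of `t` at level `k + 1` determines both ends of the link.
    have : classRep (A k) (Quotient.mk (A (k + 1)) t).out = classRep (A k) t :=
      classRep_eq (hA.refines k (classRep_rel (A (k + 1)) t))
    simp only [hB, Finset.mem_filter, Finset.mem_univ, true_and, this, rademacherSum_sub]
    exact ht
  have hexp : Real.exp (-((u * √2 ^ (k + 1)) ^ 2 / 2)) = (p ^ 2) ^ 2 ^ (k + 1) := by
    rw [mul_pow, hup, ← pow_mul, mul_comm (k + 1), pow_mul, Real.sq_sqrt (by norm_num),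
      ← Real.exp_log (pow_pos (pow_pos hp 2) (2 ^ (k + 1))), Real.log_pow, Real.log_pow]
    congr 1; push_cast; ring
  have hq : ∀ q ∈ Finset.univ, ((B q).card : ℝ) ≤ 2 * (2 ^ n * (p ^ 2) ^ 2 ^ (k + 1)) := by
    intro q _
    rw [← hexp]
    exact card_lt_abs_rademacherSum_le _ (mul_nonneg hc (hd _ _)) (by positivity) (ha _ _)
  have h1 : (S.card : ℝ) ≤ ∑ q, ((B q).card : ℝ) := by
    exact_mod_cast (Finset.card_le_card hsub).trans Finset.card_biUnion_le
  have h2 : (Fintype.card (Quotient (A (k + 1))) : ℝ) ≤ 2 ^ 2 ^ (k + 1) := by exact_mod_cast hcard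
  -- One factor `p` of `p ^ 2` absorbs the number of classes, since `2 * p ≤ 1`. What remains decays
  -- geometrically in `k` with a factor `p` to spare.
  have h3 : (2 : ℝ) ^ 2 ^ (k + 1) * (p ^ 2) ^ 2 ^ (k + 1) ≤ (1 / 8) ^ (k + 1) * p := by
    rw [← mul_pow]
    calc (2 * p ^ 2) ^ 2 ^ (k + 1) ≤ p ^ 2 ^ (k + 1) := by
          gcongr; nlinarith
      _ ≤ p ^ (k + 2) := pow_le_pow_of_le_one hp.le (by linarith) (Nat.lt_two_pow_self (n := k + 1))
      _ = p ^ (k + 1) * p := pow_succ _ _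
      _ ≤ _ := by gcongr
  calc (S.card : ℝ) ≤ ∑ q, ((B q).card : ℝ) := h1
    _ ≤ ∑ q : Quotient (A (k + 1)), 2 * (2 ^ n * (p ^ 2) ^ 2 ^ (k + 1)) := Finset.sum_le_sum hq
    _ = Fintype.card (Quotient (A (k + 1))) * (2 * (2 ^ n * (p ^ 2) ^ 2 ^ (k + 1))) := by simp
    _ ≤ 2 ^ 2 ^ (k + 1) * (2 * (2 ^ n * (p ^ 2) ^ 2 ^ (k + 1))) := by gcongr
    _ = 2 * 2 ^ n * (2 ^ 2 ^ (k + 1) * (p ^ 2) ^ 2 ^ (k + 1)) := by ring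
    _ ≤ 2 * 2 ^ n * ((1 / 8) ^ (k + 1) * p) := by gcongr
    _ = _ := by ring

/-- The deterministic part of generic chaining. -/
lemma rademacherSum_chain_le {T : Type*} {n : ℕ} {A : ℕ → Setoid T} (hA : IsAdmissible A)
    {d : T → T → ℝ} (hd : ∀ s t, 0 ≤ d s t) {a : T → Fin n → ℝ} {c : ℝ} (hc : 0 ≤ c)
    (ha : ∀ s t, ∑ i, (a s i - a t i) ^ 2 ≤ (c * d s t) ^ 2) {G u : ℝ} (hG : 0 ≤ G) (hu : 1 ≤ u)
    {t : T}
    (h : ∑' k : ℕ, ENNReal.ofReal (2 ^ ((k : ℝ) / 2)) * diameter d {s | A k s t} ≤ ENNReal.ofReal G)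
    {ε : Fin n → Bool}
    (hε : ∀ k < n, |rademacherSum (a (classRep (A (k + 1)) t)) ε -
        rademacherSum (a (classRep (A k) t)) ε| ≤
      u * √2 ^ (k + 1) * (c * d (classRep (A (k + 1)) t) (classRep (A k) t))) :
    |rademacherSum (a t) ε - rademacherSum (a (classRep (A 0) t)) ε| ≤ 3 * (u * c * G) := by
  have hs2 : √2 ≤ 2 := by rw [Real.sqrt_le_left (by norm_num)]; norm_num
  have htel : rademacherSum (a (classRep (A n) t)) ε - rademacherSum (a (classRep (A 0) t)) ε =
      ∑ k ∈ Finset.range n, (rademacherSum (a (classRep (A (k + 1)) t)) ε -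
        rademacherSum (a (classRep (A k) t)) ε) :=
    (Finset.sum_range_sub (fun k => rademacherSum (a (classRep (A k) t)) ε) n).symm
  have hsum := mul_diameter_sum_le hd hG h n (fun k => classRep (A (k + 1)) t)
    (fun k => classRep (A k) t) (fun k => hA.refines k (classRep_rel _ t)) (fun k => classRep_rel _ t)
  have hlast := mul_diameter_sum_le hd hG h (n + 1) (fun _ => t) (fun k => classRep (A k) t)
    (fun k => (A k).refl t) (fun k => classRep_rel _ t)
  have hlast' : √2 ^ n * d t (classRep (A n) t) ≤ G :=
    (Finset.single_le_sum (f := fun k => √2 ^ k * d t (classRep (A k) t))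
      (fun k _ => mul_nonneg (by positivity) (hd _ _)) (Finset.self_mem_range_succ n)).trans hlast
  have hchain : |rademacherSum (a (classRep (A n) t)) ε - rademacherSum (a (classRep (A 0) t)) ε| ≤
      2 * (u * c * G) := by
    rw [htel]
    calc _ ≤ ∑ k ∈ Finset.range n, |rademacherSum (a (classRep (A (k + 1)) t)) ε -
            rademacherSum (a (classRep (A k) t)) ε| := Finset.abs_sum_le_sum_abs _ _
      _ ≤ ∑ k ∈ Finset.range n, u * √2 ^ (k + 1) *
            (c * d (classRep (A (k + 1)) t) (classRep (A k) t)) :=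
          Finset.sum_le_sum fun k hk => hε k (Finset.mem_range.1 hk)
      _ = √2 * (u * c * ∑ k ∈ Finset.range n, √2 ^ k *
            d (classRep (A (k + 1)) t) (classRep (A k) t)) := by
          simp_rw [Finset.mul_sum]
          exact Finset.sum_congr rfl fun k _ => by ring
      _ ≤ 2 * (u * c * G) := by
          have : 0 ≤ ∑ k ∈ Finset.range n, √2 ^ k * d (classRep (A (k + 1)) t) (classRep (A k) t) :=
            Finset.sum_nonneg fun k _ => mul_nonneg (by positivity) (hd _ _)
          gcongr
  -- The chain stops at level `n`, with no limit to take: there `√n ≤ √2 ^ n`, so the crude bound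
  -- suffices for the remainder.
  have hrem : |rademacherSum (a t) ε - rademacherSum (a (classRep (A n) t)) ε| ≤ u * c * G := by
    rw [← rademacherSum_sub]
    calc _ ≤ √n * (c * d t (classRep (A n) t)) :=
          abs_rademacherSum_le _ _ (mul_nonneg hc (hd _ _)) (ha _ _)
      _ ≤ √2 ^ n * (c * d t (classRep (A n) t)) := by
          gcongr
          · exact mul_nonneg hc (hd _ _)
          · rw [Real.sqrt_le_left (by positivity), ← pow_mul, mul_comm n, pow_mul,
              Real.sq_sqrt (by norm_num)]
            exact_mod_cast (Nat.lt_two_pow_self (n := n)).le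
      _ = 1 * c * (√2 ^ n * d t (classRep (A n) t)) := by ring
      _ ≤ u * c * G := by
          have := mul_nonneg (by positivity : 0 ≤ √2 ^ n) (hd t (classRep (A n) t))
          gcongr
  calc _ ≤ _ := abs_sub_le _ (rademacherSum (a (classRep (A n) t)) ε) _
    _ ≤ _ := by linarith

/-- The generic chaining tail bound for Rademacher processes. -/
theorem card_chaining_le {T : Type*} {n : ℕ} {A : ℕ → Setoid T} (hA : IsAdmissible A)
    {d : T → T → ℝ} (hd : ∀ s t, 0 ≤ d s t) {a : T → Fin n → ℝ} {c : ℝ} (hc : 0 ≤ c)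
    (ha : ∀ s t, ∑ i, (a s i - a t i) ^ 2 ≤ (c * d s t) ^ 2) {G : ℝ} (hG : 0 ≤ G)
    (h : ∀ t, ∑' k : ℕ, ENNReal.ofReal (2 ^ ((k : ℝ) / 2)) * diameter d {s | A k s t} ≤
      ENNReal.ofReal G) {p u : ℝ} (hp : 0 < p) (hp' : p ≤ 1 / 8)
    (hu : 1 ≤ u) (hup : u ^ 2 = -(4 * Real.log p)) (S : Finset (Fin n → Bool))
    (hS : ∀ ε ∈ S, ∃ s t, 6 * (u * c * G) < |rademacherSum (a s) ε - rademacherSum (a t) ε|) :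
    (S.card : ℝ) ≤ p * 2 ^ n := by
  classical
  set B : ℕ → Finset (Fin n → Bool) := fun k => Finset.univ.filter fun ε =>
    ∃ t, u * √2 ^ (k + 1) * (c * d (classRep (A (k + 1)) t) (classRep (A k) t)) <
      |rademacherSum (a (classRep (A (k + 1)) t)) ε - rademacherSum (a (classRep (A k) t)) ε|
    with hB
  have hcard : ∀ k, ((B k).card : ℝ) ≤ 2 * (1 / 8) ^ (k + 1) * p * 2 ^ n := fun k =>
    card_link_le hA hd hc ha hp hp' (by linarith) hup k _ fun ε hε => (Finset.mem_filter.1 hε).2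
  have hsub : S ⊆ (Finset.range n).biUnion B := by
    intro ε hε
    by_contra hne
    have hgood : ∀ t, |rademacherSum (a t) ε - rademacherSum (a (classRep (A 0) t)) ε| ≤
        3 * (u * c * G) := by
      intro t
      refine rademacherSum_chain_le hA hd hc ha hG hu (h t) fun k hk => ?_
      by_contra hlt
      exact hne (Finset.mem_biUnion.2 ⟨k, Finset.mem_range.2 hk,
        Finset.mem_filter.2 ⟨Finset.mem_univ _, t, not_le.1 hlt⟩⟩)
    obtain ⟨s, t, hst⟩ := hS ε hε
    -- The partition at level `0` is trivial, so all chains start at the same point. Two chains of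
    -- length `3 * (u * c * G)` give the factor `6`.
    have hrep : classRep (A 0) s = classRep (A 0) t := classRep_eq (by rw [hA.zero]; trivial)
    have h1 := hgood s
    have h2 := hgood t
    rw [hrep] at h1
    rw [abs_sub_comm] at h2
    have h3 := abs_sub_le (rademacherSum (a s) ε) (rademacherSum (a (classRep (A 0) t)) ε)
      (rademacherSum (a t) ε)
    linarith
  have hgeom : ∀ K : ℕ, ∑ k ∈ Finset.range K, (2 : ℝ) * (1 / 8) ^ (k + 1) ≤ 1 - (1 / 8) ^ K := by
    intro K
    induction K with
    | zero => simp
    | succ K ih =>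
      rw [Finset.sum_range_succ, pow_succ]
      have : (0 : ℝ) < (1 / 8) ^ K := by positivity
      linarith
  calc (S.card : ℝ) ≤ ∑ k ∈ Finset.range n, ((B k).card : ℝ) := by
        exact_mod_cast (Finset.card_le_card hsub).trans Finset.card_biUnion_le
    _ ≤ ∑ k ∈ Finset.range n, 2 * (1 / 8) ^ (k + 1) * p * 2 ^ n :=
        Finset.sum_le_sum fun k _ => hcard k
    _ = (∑ k ∈ Finset.range n, (2 : ℝ) * (1 / 8) ^ (k + 1)) * (p * 2 ^ n) := by
        rw [Finset.sum_mul]; exact Finset.sum_congr rfl fun k _ => by ring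
    _ ≤ 1 * (p * 2 ^ n) := by
        gcongr
        have := hgeom n
        have : (0 : ℝ) < (1 / 8) ^ n := by positivity
        linarith
    _ = _ := one_mul _

/-- The tail bound in terms of the `γ₂` functional. -/
theorem card_gammaFunctional_le {T : Type*} {n : ℕ}
    {d : T → T → ℝ} (hd : ∀ s t, 0 ≤ d s t) {a : T → Fin n → ℝ} {c : ℝ} (hc : 0 ≤ c)
    (ha : ∀ s t, ∑ i, (a s i - a t i) ^ 2 ≤ (c * d s t) ^ 2) {G : ℝ}
    (hG : 0 ≤ G) (h : gammaFunctional 2 d < ENNReal.ofReal G) {p u : ℝ} (hp : 0 < p)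
    (hp' : p ≤ 1 / 8) (hu : 1 ≤ u) (hup : u ^ 2 = -(4 * Real.log p)) (S : Finset (Fin n → Bool))
    (hS : ∀ ε ∈ S, ∃ s t, 6 * (u * c * G) < |rademacherSum (a s) ε - rademacherSum (a t) ε|) :
    (S.card : ℝ) ≤ p * 2 ^ n := by
  unfold gammaFunctional at h
  simp only [iInf_lt_iff] at h
  obtain ⟨A, hA, h⟩ := h
  exact card_chaining_le hA hd hc ha hG (fun t => (le_iSup (fun t => ∑' n : ℕ, ENNReal.ofReal (2 ^ ((n : ℝ) / 2)) *
    diameter d {s | A n s t}) t).trans h.le) hp hp' hu hup S hS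

/-! ### Symmetrization in probability -/

/-- Exchange the coordinates of two samples at the positions where `ε` is `false`. -/
def swapSample {𝒵 : Type*} {n : ℕ} (ε : Fin n → Bool) (p : (Fin n → 𝒵) × (Fin n → 𝒵)) :
    (Fin n → 𝒵) × (Fin n → 𝒵) :=
  (fun i => cond (ε i) (p.1 i) (p.2 i), fun i => cond (ε i) (p.2 i) (p.1 i))

/-- Regrouped as `n` independent pairs, the two samples undergo in each coordinate either the
identity or the swap of `P.prod P`, and both preserve it. -/
lemma measurePreserving_swapSample {𝒵 : Type*} [MeasurableSpace 𝒵] (P : Measure 𝒵)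
    [IsProbabilityMeasure P] {n : ℕ} (ε : Fin n → Bool) :
    MeasurePreserving (swapSample ε)
      ((Measure.pi fun _ : Fin n => P).prod (Measure.pi fun _ : Fin n => P))
      ((Measure.pi fun _ : Fin n => P).prod (Measure.pi fun _ : Fin n => P)) := by
  have e := measurePreserving_arrowProdEquivProdArrow 𝒵 𝒵 (Fin n) (fun _ => P) (fun _ => P)
  have hf : ∀ i, MeasurePreserving (fun q : 𝒵 × 𝒵 => cond (ε i) q q.swap) (P.prod P) (P.prod P) := by
    intro i
    cases ε i
    · exact Measure.measurePreserving_swap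
    · exact MeasurePreserving.id _
  have h := (e.comp (measurePreserving_pi (fun _ => P.prod P) (fun _ => P.prod P) hf)).comp
    (e.symm _)
  convert h using 1
  funext p
  refine Prod.ext (funext fun i => ?_) (funext fun i => ?_) <;>
  · simp only [swapSample, Function.comp, MeasurableEquiv.arrowProdEquivProdArrow,
      Equiv.arrowProdEquivProdArrow]
    cases hε : ε i <;> simp [hε, MeasurableEquiv.symm]

lemma sum_swapSample_sub {𝒵 : Type*} {n : ℕ} (ε : Fin n → Bool) (s s' : Fin n → 𝒵) (g : 𝒵 → ℝ) :
    ∑ i, (g ((swapSample ε (s, s')).2 i) - g ((swapSample ε (s, s')).1 i)) =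
      rademacherSum (fun i => g (s' i)) ε - rademacherSum (fun i => g (s i)) ε := by
  rw [← rademacherSum_sub]
  unfold rademacherSum swapSample
  refine Finset.sum_congr rfl fun i _ => ?_
  cases hε : ε i <;> simp [hε]

/-- Symmetrization by random exchange: an event for a pair of samples is unlikely if, outside a set
of exceptional samples, few of the exchanged pairs belong to it. -/
lemma measure_le_of_card_swapSample_le {𝒵 : Type*} [MeasurableSpace 𝒵] (P : Measure 𝒵)
    [IsProbabilityMeasure P] {n : ℕ} {E : Set ((Fin n → 𝒵) × (Fin n → 𝒵))} (hE : MeasurableSet E)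
    (N : Set (Fin n → 𝒵)) {p : ℝ≥0∞}
    (h : ∀ s s', s ∉ N → s' ∉ N → ∀ S : Finset (Fin n → Bool),
      (∀ ε ∈ S, swapSample ε (s, s') ∈ E) → (S.card : ℝ≥0∞) ≤ p * 2 ^ n) :
    ((Measure.pi fun _ : Fin n => P).prod (Measure.pi fun _ : Fin n => P)) E ≤
      2 * (Measure.pi fun _ : Fin n => P) N + p := by
  classical
  set μ := Measure.pi fun _ : Fin n => P with hμ
  -- `N` need not be measurable, so it is replaced by a measurable hull of the same measure.
  set N' := toMeasurable μ N
  have hN' : MeasurableSet N' := measurableSet_toMeasurable _ _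
  -- All `2 ^ n` preimages of `E` under the exchanges have the measure of `E`; counting patterns
  -- pointwise therefore bounds it.
  have hsum : (2 : ℝ≥0∞) ^ n * (μ.prod μ) E =
      ∫⁻ x, ∑ ε : Fin n → Bool, (swapSample ε ⁻¹' E).indicator 1 x ∂(μ.prod μ) := by
    have hm : ∀ ε : Fin n → Bool, MeasurableSet (swapSample ε ⁻¹' E) := fun ε =>
      (measurePreserving_swapSample P ε).measurable hE
    rw [lintegral_finsetSum _ fun ε _ => measurable_one.indicator (hm ε)]
    simp_rw [lintegral_indicator_one (hm _)]
    rw [Finset.sum_congr rfl fun ε _ =>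
      (measurePreserving_swapSample P ε).measure_preimage hE.nullMeasurableSet]
    simp [hμ]
  set V : Set ((Fin n → 𝒵) × (Fin n → 𝒵)) := N' ×ˢ univ ∪ univ ×ˢ N'
  have hV : MeasurableSet V := (hN'.prod .univ).union (MeasurableSet.univ.prod hN')
  have hVle : (μ.prod μ) V ≤ 2 * μ N := by
    refine (measure_union_le _ _).trans ?_
    rw [Measure.prod_prod, Measure.prod_prod, measure_toMeasurable, measure_univ, two_mul]
    simp
  have hpt : ∀ x, ∑ ε : Fin n → Bool, (swapSample ε ⁻¹' E).indicator (1 : (Fin n → 𝒵) × (Fin n → 𝒵) → ℝ≥0∞) x ≤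
      2 ^ n * (V.indicator 1 x + p) := by
    rintro ⟨s, s'⟩
    have hcard : ∑ ε : Fin n → Bool, (swapSample ε ⁻¹' E).indicator (1 : (Fin n → 𝒵) × (Fin n → 𝒵) → ℝ≥0∞) (s, s') =
        (Finset.univ.filter fun ε => swapSample ε (s, s') ∈ E).card := by
      simp [Set.indicator_apply]
    rw [hcard]
    by_cases hx : (s, s') ∈ V
    · rw [indicator_of_mem hx]
      calc _ ≤ ((Finset.univ : Finset (Fin n → Bool)).card : ℝ≥0∞) := by
            exact_mod_cast Finset.card_filter_le _ _
        _ = 2 ^ n * 1 := by simp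
        _ ≤ _ := by gcongr; exact le_self_add
    · have hs : s ∉ N := fun hs => hx (Or.inl ⟨subset_toMeasurable _ _ hs, mem_univ _⟩)
      have hs' : s' ∉ N := fun hs => hx (Or.inr ⟨mem_univ _, subset_toMeasurable _ _ hs⟩)
      rw [indicator_of_notMem hx, zero_add, mul_comm]
      exact h s s' hs hs' _ fun ε hε => (Finset.mem_filter.1 hε).2
  have hfin : (2 : ℝ≥0∞) ^ n * (μ.prod μ) E ≤ 2 ^ n * (2 * μ N + p) := by
    rw [hsum]
    refine (lintegral_mono hpt).trans ?_
    rw [lintegral_const_mul _ ((measurable_one.indicator hV).add_const _),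
      lintegral_add_left (measurable_one.indicator hV), lintegral_indicator_one hV]
    simp only [lintegral_const, measure_univ, mul_one]
    gcongr
  exact (ENNReal.mul_le_mul_iff_right (by simp) (by simp)).1 hfin

/-- Chebyshev's inequality for an empirical mean. -/
lemma half_le_measure_empirical {𝒵 : Type*} [MeasurableSpace 𝒵] (P : Measure 𝒵)
    [IsProbabilityMeasure P] {n : ℕ} {g : 𝒵 → ℝ} (hg : MemLp g 2 P) {v t : ℝ} (ht : 0 < t)
    (hv : ∫ z, g z ^ 2 ∂P ≤ v) (hvt : 2 * v ≤ n * t ^ 2) (hn : 0 < n) :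
    1 / 2 ≤ (Measure.pi fun _ : Fin n => P) {s | n * (∫ z, g z ∂P) - n * t < ∑ i, g (s i)} := by
  set μ := Measure.pi fun _ : Fin n => P with hμ
  have hn' : (0 : ℝ) < n := by exact_mod_cast hn
  set X : (Fin n → 𝒵) → ℝ := ∑ i : Fin n, fun s => g (s i) with hX
  have hmem : ∀ i : Fin n, MemLp (fun s : Fin n → 𝒵 => g (s i)) 2 μ := fun i =>
    hg.comp_measurePreserving (measurePreserving_eval _ i)
  have hXmem : MemLp X 2 μ := memLp_finsetSum' _ fun i _ => hmem i
  have hXint : ∫ s, X s ∂μ = n * ∫ z, g z ∂P := by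
    simp only [hX, Finset.sum_apply]
    rw [integral_finsetSum _ fun i _ => (hmem i).integrable (by norm_num)]
    rw [Finset.sum_congr rfl fun i _ => integral_comp_eval (μ := fun _ : Fin n => P) (i := i) hg.1]
    simp
  have hvar : ProbabilityTheory.variance X μ ≤ n * v := by
    rw [hX, ProbabilityTheory.variance_sum_pi (X := fun _ => g) fun _ => hg]
    have : ProbabilityTheory.variance g P ≤ v :=
      (ProbabilityTheory.variance_le_expectation_sq hg.1).trans hv
    simpa using mul_le_mul_of_nonneg_left this hn'.le
  have hcheb := ProbabilityTheory.meas_ge_le_variance_div_sq hXmem (c := n * t) (by positivity)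
  have hbound : ENNReal.ofReal (ProbabilityTheory.variance X μ / (n * t) ^ 2) ≤ 1 / 2 := by
    have h1 : ProbabilityTheory.variance X μ / (n * t) ^ 2 ≤ 1 / 2 := by
      rw [div_le_div_iff₀ (by positivity) (by norm_num)]
      nlinarith
    refine (ENNReal.ofReal_le_ofReal h1).trans ?_
    rw [ENNReal.ofReal_div_of_pos (by norm_num)]
    simp
  have huniv : (univ : Set (Fin n → 𝒵)) ⊆
      {s | n * (∫ z, g z ∂P) - n * t < ∑ i, g (s i)} ∪ {s | n * t ≤ |X s - ∫ s, X s ∂μ|} := by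
    intro s _
    by_cases hs : n * (∫ z, g z ∂P) - n * t < ∑ i, g (s i)
    · exact Or.inl hs
    · right
      have hXs : X s = ∑ i, g (s i) := by simp [hX]
      rw [mem_ofPred_eq, hXint, hXs, le_abs]
      right
      linarith [not_lt.1 hs]
  have h1 : (1 : ℝ≥0∞) ≤ μ {s | n * (∫ z, g z ∂P) - n * t < ∑ i, g (s i)} + 1 / 2 := by
    calc (1 : ℝ≥0∞) = μ univ := measure_univ.symm
      _ ≤ _ := measure_mono huniv
      _ ≤ _ := measure_union_le _ _
      _ ≤ _ := by gcongr; exact hcheb.trans hbound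
  refine (ENNReal.add_le_add_iff_right (a := 1 / 2) (by simp)).1 ?_
  rwa [ENNReal.add_halves]

/-- Symmetrization in probability for the deviation of a data-dependent function. -/
theorem measure_deviation_le {𝒵 : Type*} [MeasurableSpace 𝒵] (P : Measure 𝒵)
    [IsProbabilityMeasure P] {n : ℕ} (hn : 0 < n) {g : (Fin n → 𝒵) → 𝒵 → ℝ}
    (hg : Measurable (Function.uncurry g)) {v t : ℝ} (ht : 0 < t)
    (hint : ∀ s, MemLp (g s) 2 P) (hv : ∀ s, ∫ z, g s z ^ 2 ∂P ≤ v) (hvt : 2 * v ≤ n * t ^ 2)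
    (N : Set (Fin n → 𝒵)) {p : ℝ≥0∞}
    (h : ∀ s s', s ∉ N → s' ∉ N → ∀ S : Finset (Fin n → Bool),
      (∀ ε ∈ S, ∃ r, n * t < rademacherSum (fun i => g r (s' i)) ε -
        rademacherSum (fun i => g r (s i)) ε) → (S.card : ℝ≥0∞) ≤ p * 2 ^ n) :
    (Measure.pi fun _ : Fin n => P) {s | 2 * (n * t) < n * (∫ z, g s z ∂P) - ∑ i, g s (s i)} ≤
      2 * (2 * (Measure.pi fun _ : Fin n => P) N + p) := by
  set μ := Measure.pi fun _ : Fin n => P with hμ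
  have hgm : ∀ i : Fin n, Measurable fun x : (Fin n → 𝒵) × (Fin n → 𝒵) => g x.1 (x.2 i) :=
    fun i => hg.comp (measurable_fst.prodMk ((measurable_pi_apply i).comp measurable_snd))
  have hgm' : ∀ i : Fin n, Measurable fun x : (Fin n → 𝒵) × (Fin n → 𝒵) => g x.1 (x.1 i) :=
    fun i => hg.comp (measurable_fst.prodMk ((measurable_pi_apply i).comp measurable_fst))
  have hgd : ∀ i : Fin n, Measurable fun s : (Fin n → 𝒵) => g s (s i) :=
    fun i => hg.comp (measurable_id.prodMk (measurable_pi_apply i))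
  set E : Set ((Fin n → 𝒵) × (Fin n → 𝒵)) :=
    {x | n * t < ∑ i, (g x.1 (x.2 i) - g x.1 (x.1 i))} with hEdef
  have hE : MeasurableSet E := measurableSet_lt measurable_const
    (Finset.measurable_fun_sum _ fun i _ => (hgm i).sub (hgm' i))
  -- The index `r` is the exchanged first sample and varies with `ε`, hence the existential
  -- quantifier over `r` in the hypothesis `h`.
  have hEle := measure_le_of_card_swapSample_le P hE N (p := p) fun s s' hs hs' S hS =>
    h s s' hs hs' S fun ε hε => ⟨(swapSample ε (s, s')).1, by
      rw [← sum_swapSample_sub]; exact hS ε hε⟩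
  have hr : Measurable fun s => ∫ z, g s z ∂P :=
    (hg.stronglyMeasurable.integral_prod_right (ν := P)).measurable
  set D : Set (Fin n → 𝒵) := {s | 2 * (n * t) < n * (∫ z, g s z ∂P) - ∑ i, g s (s i)} with hDdef
  have hD : MeasurableSet D := measurableSet_lt measurable_const
    ((hr.const_mul _).sub (Finset.measurable_fun_sum _ fun i _ => hgd i))
  -- For `s` in `D` the function `g s` is fixed, and at least half of the ghost samples lose no more
  -- than `n * t` of the deviation `2 * (n * t)`.
  have hsec : ∀ s, D.indicator (fun _ => (1 / 2 : ℝ≥0∞)) s ≤ μ (Prod.mk s ⁻¹' E) := by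
    intro s
    by_cases hs : s ∈ D
    · rw [indicator_of_mem hs]
      refine (half_le_measure_empirical P (hint s) ht (hv s) hvt hn).trans (measure_mono ?_)
      intro s' hs'
      have hs : 2 * (n * t) < n * (∫ z, g s z ∂P) - ∑ i, g s (s i) := hs
      simp only [mem_ofPred_eq] at hs'
      simp only [hEdef, mem_preimage, mem_ofPred_eq, Finset.sum_sub_distrib]
      linarith
    · rw [indicator_of_notMem hs]; exact zero_le
  have hlow : 1 / 2 * μ D ≤ (μ.prod μ) E := by
    rw [Measure.prod_apply hE, ← lintegral_indicator_const hD]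
    exact lintegral_mono hsec
  calc μ D = 2 * (1 / 2 * μ D) := by
        rw [← mul_assoc, one_div, ENNReal.mul_inv_cancel (by simp) (by simp), one_mul]
    _ ≤ 2 * (2 * μ N + p) := by gcongr; exact hlow.trans hEle

/-! ### Truncation functions and the slope `β` -/

section Truncation

variable {φ : ℝ → ℝ → ℝ} {M α : ℝ}

lemma TruncatedRisk.IsTruncation.halfDeriv_nonneg (h : IsTruncation φ M) (hα : 0 < α) {x : ℝ}
    (hx : 0 ≤ x) : 0 ≤ halfDeriv (φ α) x :=
  le_of_tendsto (h.deriv_tendsto α hα) <| (eventually_ge_atTop x).mono fun _ hy =>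
    h.deriv_antitone α hα hx (hx.trans hy) hy

lemma TruncatedRisk.IsTruncation.halfDeriv_le_one (h : IsTruncation φ M) (hα : 0 < α) {x : ℝ}
    (hx : 0 ≤ x) : halfDeriv (φ α) x ≤ 1 :=
  (h.deriv_antitone α hα self_mem_Ici hx hx).trans_eq (h.deriv_zero α hα)

/-- As the derivative is non-increasing, its value at `min x y` bounds it on the whole segment.
Slope bounds at the two endpoints thus suffice, and `β`, a supremum over attained values only,
serves as Lipschitz constant. -/
lemma TruncatedRisk.IsTruncation.abs_sub_le_mul (h : IsTruncation φ M) (hα : 0 < α) {b x y : ℝ}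
    (hx : 0 ≤ x) (hy : 0 ≤ y) (hbx : halfDeriv (φ α) x ≤ b) (hby : halfDeriv (φ α) y ≤ b) :
    |φ α x - φ α y| ≤ b * |x - y| := by
  have hm : 0 ≤ min x y := le_min hx hy
  have hsub : Ici (min x y) ⊆ Ici (0 : ℝ) := Ici_subset_Ici.2 hm
  have hbm : halfDeriv (φ α) (min x y) ≤ b := by
    rcases min_choice x y with h | h <;> rwa [h]
  refine Convex.norm_image_sub_le_of_norm_hasDerivWithin_le (f' := halfDeriv (φ α))
    (s := Ici (min x y)) (fun w hw => ?_) (fun w hw => ?_) (convex_Ici _) (min_le_right x y)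
    (min_le_left x y)
  · exact ((((h.contDiffOn α hα).differentiableOn (by norm_num)) w (hsub hw)).hasDerivWithinAt).mono
      hsub
  · rw [Real.norm_of_nonneg (h.halfDeriv_nonneg hα (hsub hw))]
    exact (h.deriv_antitone α hα hm (hsub hw) hw).trans hbm

variable {𝒵 : Type*} {F : Set (𝒵 → ℝ)}

lemma TruncatedRisk.IsTruncation.le_truncSlope (h : IsTruncation φ M) (hα : 0 < α)
    (hF : ∀ f ∈ F, ∀ z, 0 ≤ f z) {f : 𝒵 → ℝ} (hf : f ∈ F) (z : 𝒵) :
    halfDeriv (φ α) (f z) ≤ truncSlope φ F α := by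
  refine le_csSup ⟨1, ?_⟩ ⟨f, hf, z, rfl⟩
  rintro _ ⟨g, hg, w, rfl⟩
  exact h.halfDeriv_le_one hα (hF g hg w)

lemma TruncatedRisk.IsTruncation.truncSlope_nonneg (h : IsTruncation φ M) (hα : 0 < α)
    (hF : ∀ f ∈ F, ∀ z, 0 ≤ f z) : 0 ≤ truncSlope φ F α := by
  refine Real.sSup_nonneg ?_
  rintro _ ⟨g, hg, w, rfl⟩
  exact h.halfDeriv_nonneg hα (hF g hg w)

lemma TruncatedRisk.IsTruncation.truncSlope_le_one (h : IsTruncation φ M) (hα : 0 < α)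
    (hF : ∀ f ∈ F, ∀ z, 0 ≤ f z) : truncSlope φ F α ≤ 1 := by
  refine Real.sSup_le ?_ zero_le_one
  rintro _ ⟨g, hg, w, rfl⟩
  exact h.halfDeriv_le_one hα (hF g hg w)

lemma TruncatedRisk.IsTruncation.truncSlope_mono (h : IsTruncation φ M)
    (hF : ∀ f ∈ F, ∀ z, 0 ≤ f z) : MonotoneOn (truncSlope φ F) (Ioi 0) := by
  intro a ha b hb hab
  refine Real.sSup_le ?_ (h.truncSlope_nonneg hb hF)
  rintro _ ⟨g, hg, w, rfl⟩
  exact (h.deriv_mono a b ha hab _ (hF g hg w)).trans (h.le_truncSlope hb hF hg w)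

end Truncation

/-! ### Second moments and the truncation bias -/

section Moments

variable {𝒵 : Type*} [MeasurableSpace 𝒵] {P : Measure 𝒵} {F : Set (𝒵 → ℝ)} {σ : ℝ}

lemma memLp_two_of_integrable_sq {f : 𝒵 → ℝ} (hf : Measurable f)
    (h : Integrable (fun z => f z ^ 2) P) : MemLp f 2 P :=
  (memLp_two_iff_integrable_sq hf.aestronglyMeasurable).2 h

lemma popDist_le (hσ : 0 ≤ σ) (hm : ∀ f ∈ F, Measurable f)
    (h2 : ∀ f ∈ F, Integrable (fun z => f z ^ 2) P ∧ ∫ z, f z ^ 2 ∂P ≤ σ ^ 2) {f g : 𝒵 → ℝ}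
    (hf : f ∈ F) (hg : g ∈ F) : popDist P f g ≤ 2 * σ := by
  unfold popDist
  rw [Real.sqrt_le_left (by positivity)]
  have hfg := ((memLp_two_of_integrable_sq (hm f hf) (h2 f hf).1).sub
    (memLp_two_of_integrable_sq (hm g hg) (h2 g hg).1)).integrable_sq
  calc ∫ z, (f z - g z) ^ 2 ∂P ≤ ∫ z, (2 * f z ^ 2 + 2 * g z ^ 2) ∂P := by
        refine integral_mono hfg (((h2 f hf).1.const_mul 2).add ((h2 g hg).1.const_mul 2))
          fun z => ?_
        simp only
        nlinarith [sq_nonneg (f z + g z)]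
    _ = 2 * ∫ z, f z ^ 2 ∂P + 2 * ∫ z, g z ^ 2 ∂P := by
        rw [integral_add ((h2 f hf).1.const_mul 2) ((h2 g hg).1.const_mul 2), integral_const_mul,
          integral_const_mul]
    _ ≤ (2 * σ) ^ 2 := by linarith [(h2 f hf).2, (h2 g hg).2]

lemma diameter_popDist_lt_top (hσ : 0 ≤ σ) (hm : ∀ f ∈ F, Measurable f)
    (h2 : ∀ f ∈ F, Integrable (fun z => f z ^ 2) P ∧ ∫ z, f z ^ 2 ∂P ≤ σ ^ 2) :
    diameter (popDist P) F < ⊤ :=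
  lt_of_le_of_lt (iSup₂_le fun _ hf => iSup₂_le fun _ hg =>
    ENNReal.ofReal_le_ofReal (popDist_le hσ hm h2 hf hg)) ENNReal.ofReal_lt_top

lemma integral_sq_sub_le_diameter (hd : diameter (popDist P) F < ⊤) {f g : 𝒵 → ℝ}
    (hf : f ∈ F) (hg : g ∈ F) :
    ∫ z, (f z - g z) ^ 2 ∂P ≤ (diameter (popDist P) F).toReal ^ 2 := by
  have h := ENNReal.toReal_mono hd.ne (ofReal_le_diameter (popDist P) hf hg)
  rw [popDist, ENNReal.toReal_ofReal (Real.sqrt_nonneg _)] at h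
  rw [← Real.sqrt_le_left ENNReal.toReal_nonneg]
  exact h

/-- Integrating `|φ α x - x| ≤ M x² / α` turns the second moment bound into a bias bound. -/
lemma abs_integral_truncation_sub_le [IsProbabilityMeasure P] {φ : ℝ → ℝ → ℝ} {M α : ℝ}
    (hφ : IsTruncation φ M) (hα : 0 < α)
    {f : 𝒵 → ℝ} (hf0 : ∀ z, 0 ≤ f z) (hm : Measurable f)
    (hmφ : Measurable fun z => φ α (f z)) (hi : Integrable (fun z => f z ^ 2) P)
    (h2 : ∫ z, f z ^ 2 ∂P ≤ σ ^ 2) :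
    Integrable (fun z => φ α (f z)) P ∧ |∫ z, φ α (f z) ∂P - risk P f| ≤ M * σ ^ 2 / α := by
  have hfi : Integrable f P := (memLp_two_of_integrable_sq hm hi).integrable (by norm_num)
  have hbi : Integrable (fun z => M * f z ^ 2 / α) P := (hi.const_mul M).div_const α
  have hbound : ∀ z, ‖φ α (f z) - f z‖ ≤ M * f z ^ 2 / α := fun z =>
    hφ.abs_sub_le α hα _ (hf0 z)
  have hdi : Integrable (fun z => φ α (f z) - f z) P :=
    hbi.mono' (hmφ.sub hm).aestronglyMeasurable (ae_of_all _ hbound)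
  have hφi : Integrable (fun z => φ α (f z)) P := by
    refine (hdi.add hfi).congr (ae_of_all _ fun z => ?_)
    simp
  refine ⟨hφi, ?_⟩
  unfold risk
  rw [← integral_sub hφi hfi]
  calc _ ≤ ∫ z, M * f z ^ 2 / α ∂P := norm_integral_le_of_norm_le hbi (ae_of_all _ hbound)
    _ = M * (∫ z, f z ^ 2 ∂P) / α := by rw [integral_div, integral_const_mul]
    _ ≤ M * σ ^ 2 / α := by
        have := hφ.const_pos
        gcongr

end Moments

/-! ### The symmetrized truncated process -/

/-- If the values of a truncation at the sample are compared to the empirical distance, then the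
chaining tail bound applies. -/
lemma card_truncated_process_le {𝒵 : Type*} {n : ℕ} (hn : 0 < n) {F : Set (𝒵 → ℝ)} {ψ : ℝ → ℝ}
    {b : ℝ} (hb : 0 ≤ b) (hψ : ∀ f ∈ F, ∀ g ∈ F, ∀ z, |ψ (f z) - ψ (g z)| ≤ b * |f z - g z|)
    (s : Fin n → 𝒵) {G : ℝ} (hG : 0 ≤ G)
    (hγ : gammaFunctional 2 (fun f g : F => empDist s f g) < ENNReal.ofReal G) {p u : ℝ} (hp : 0 < p)
    (hp' : p ≤ 1 / 8) (hu : 1 ≤ u) (hup : u ^ 2 = -(4 * Real.log p)) (S : Finset (Fin n → Bool))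
    (hS : ∀ ε ∈ S, ∃ f ∈ F, ∃ g ∈ F, 6 * (u * (b * √n) * G) <
      |rademacherSum (fun i => ψ (f (s i)) - ψ (g (s i))) ε|) :
    (S.card : ℝ) ≤ p * 2 ^ n := by
  have hn' : (0 : ℝ) < n := by exact_mod_cast hn
  -- The factor `√n` in `c` undoes the normalization `1 / n` inside `empDist`.
  refine card_gammaFunctional_le (T := F) (d := fun f g : F => empDist s f g)
    (a := fun f i => ψ (f.1 (s i))) (c := b * √n) (fun f g => Real.sqrt_nonneg _) (by positivity)
    (fun f g => ?_) hG hγ hp hp' hu hup S fun ε hε => ?_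
  · unfold empDist
    have hnn : 0 ≤ ∑ i, (f.1 (s i) - g.1 (s i)) ^ 2 := Finset.sum_nonneg fun i _ => sq_nonneg _
    rw [mul_pow, mul_pow, Real.sq_sqrt hn'.le, Real.sq_sqrt (by positivity)]
    have : b ^ 2 * n * (1 / n * ∑ i, (f.1 (s i) - g.1 (s i)) ^ 2) =
        ∑ i, b ^ 2 * (f.1 (s i) - g.1 (s i)) ^ 2 := by
      rw [← Finset.mul_sum]; field_simp
    rw [this]
    refine Finset.sum_le_sum fun i _ => ?_
    rw [← mul_pow, ← sq_abs]
    calc |ψ (f.1 (s i)) - ψ (g.1 (s i))| ^ 2 ≤ (b * |f.1 (s i) - g.1 (s i)|) ^ 2 := by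
          gcongr; exact hψ _ f.2 _ g.2 _
      _ = _ := by rw [mul_pow, sq_abs, mul_pow]
  · obtain ⟨f, hf, g, hg, h⟩ := hS ε hε
    exact ⟨⟨f, hf⟩, ⟨g, hg⟩, by rwa [rademacherSum_sub] at h⟩

/-- Few patterns of signs make the symmetrized deviation between two samples large. -/
lemma card_symmetrized_le {𝒵 ι : Type*} {n : ℕ} (hn : 0 < n) {F : Set (𝒵 → ℝ)} {ψ : ℝ → ℝ}
    {b : ℝ} (hb : 0 ≤ b) (hψ : ∀ f ∈ F, ∀ g ∈ F, ∀ z, |ψ (f z) - ψ (g z)| ≤ b * |f z - g z|)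
    {s s' : Fin n → 𝒵} {G : ℝ} (hG : 0 ≤ G)
    (hs : gammaFunctional 2 (fun f g : F => empDist s f g) < ENNReal.ofReal G)
    (hs' : gammaFunctional 2 (fun f g : F => empDist s' f g) < ENNReal.ofReal G)
    {p u : ℝ} (hp : 0 < p) (hp' : p ≤ 1 / 8) (hu : 1 ≤ u) (hup : u ^ 2 = -(4 * Real.log p))
    {f : ι → 𝒵 → ℝ} (hf : ∀ r, f r ∈ F) {f₀ : 𝒵 → ℝ} (hf₀ : f₀ ∈ F) (S : Finset (Fin n → Bool))
    (hS : ∀ ε ∈ S, ∃ r, 2 * (6 * (u * (b * √n) * G)) <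
      rademacherSum (fun i => ψ (f r (s' i)) - ψ (f₀ (s' i))) ε -
        rademacherSum (fun i => ψ (f r (s i)) - ψ (f₀ (s i))) ε) :
    (S.card : ℝ) ≤ 2 * p * 2 ^ n := by
  classical
  set B : (Fin n → 𝒵) → Finset (Fin n → Bool) := fun s => S.filter fun ε =>
    ∃ r, 6 * (u * (b * √n) * G) < |rademacherSum (fun i => ψ (f r (s i)) - ψ (f₀ (s i))) ε| with hB
  have hone : ∀ s, gammaFunctional 2 (fun f g : F => empDist s f g) < ENNReal.ofReal G →
      ((B s).card : ℝ) ≤ p * 2 ^ n := fun s hs =>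
    card_truncated_process_le hn hb hψ s hG hs hp hp' hu hup _ fun ε hε => by
      obtain ⟨r, hr⟩ := (Finset.mem_filter.1 hε).2
      exact ⟨_, hf r, _, hf₀, hr⟩
  -- A difference above twice the threshold makes one of the two sums exceed it in absolute value.
  have hsub : S ⊆ B s' ∪ B s := by
    intro ε hε
    obtain ⟨r, hr⟩ := hS ε hε
    rw [Finset.mem_union, Finset.mem_filter, Finset.mem_filter]
    by_contra! hcon
    have h1 := hcon.1 hε r
    have h2 := hcon.2 hε r
    have h3 := le_abs_self (rademacherSum (fun i => ψ (f r (s' i)) - ψ (f₀ (s' i))) ε)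
    have h4 := neg_abs_le (rademacherSum (fun i => ψ (f r (s i)) - ψ (f₀ (s i))) ε)
    linarith
  have hcard : (S.card : ℝ) ≤ (B s').card + (B s).card := by
    exact_mod_cast (Finset.card_le_card hsub).trans (Finset.card_union_le _ _)
  have := hone s hs
  have := hone s' hs'
  linarith

/-- Right continuity of a distribution function along a sequence. -/
lemma le_measureReal_of_tendsto {Ω : Type*} [MeasurableSpace Ω] (μ : Measure Ω)
    [IsFiniteMeasure μ] {X : Ω → ℝ} (hX : Measurable X) {τ : ℕ → ℝ} {τ₀ p : ℝ} (hτ : Antitone τ)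
    (hlim : Tendsto τ atTop (𝓝 τ₀)) (h : ∀ k, p ≤ μ.real {ω | X ω ≤ τ k}) :
    p ≤ μ.real {ω | X ω ≤ τ₀} := by
  have hset : {ω | X ω ≤ τ₀} = ⋂ k, {ω | X ω ≤ τ k} := by
    ext ω
    simp only [mem_ofPred_eq, mem_iInter]
    exact ⟨fun hω k => hω.trans (hτ.le_of_tendsto hlim k), fun hω => ge_of_tendsto' hlim hω⟩
  have ht := tendsto_measure_iInter_atTop (μ := μ) (s := fun k => {ω | X ω ≤ τ k})
    (fun k => (measurableSet_le hX measurable_const).nullMeasurableSet)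
    (fun i j hij ω hω => le_trans hω (hτ hij)) ⟨0, measure_ne_top _ _⟩
  rw [hset]
  exact ge_of_tendsto' ((ENNReal.tendsto_toReal (measure_ne_top _ _)).comp ht) h

/-! ### The excess risk bound -/

section ExcessRisk

variable {𝒵 : Type*} [MeasurableSpace 𝒵] {P : Measure 𝒵} [IsProbabilityMeasure P]
  {F : Set (𝒵 → ℝ)} {σ : ℝ} {φ : ℝ → ℝ → ℝ} {M α : ℝ} {fstar : 𝒵 → ℝ} {n : ℕ}
  {fhat : (Fin n → 𝒵) → 𝒵 → ℝ} {δ : ℝ} {Γ : ℝ≥0}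

lemma TruncatedRisk.IsTruncation.measurable_comp {Ω : Type*} [MeasurableSpace Ω]
    (hφ : IsTruncation φ M) (hα : 0 < α) {f : Ω → ℝ} (hf0 : ∀ z, 0 ≤ f z) (hf : Measurable f) :
    Measurable fun z => φ α (f z) := by
  -- Nothing is known about `φ α` on the negative axis; `max x 0` avoids it.
  have hc : Continuous fun x : ℝ => φ α (max x 0) :=
    (hφ.contDiffOn α hα).continuousOn.comp_continuous (by fun_prop) fun x => le_max_right x 0
  simpa [Function.comp_def, max_eq_left (hf0 _)] using hc.measurable.comp hf

/-- The excess risk bound, with the slope and the complexity replaced by larger numbers. -/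
lemma excess_risk_le_of_lt (hF0 : ∀ f ∈ F, ∀ z, 0 ≤ f z) (hm : ∀ f ∈ F, Measurable f)
    (hσ : 0 < σ) (h2 : ∀ f ∈ F, Integrable (fun z => f z ^ 2) P ∧ ∫ z, f z ^ 2 ∂P ≤ σ ^ 2)
    (hφ : IsTruncation φ M) (hα : 0 < α) (hstar : fstar ∈ F) (hn : 0 < n)
    (hmeas : Measurable (fun p : (Fin n → 𝒵) × 𝒵 => fhat p.1 p.2))
    (hhat : ∀ s, fhat s ∈ F ∧ ∀ f ∈ F, empTruncRisk (φ α) s (fhat s) ≤ empTruncRisk (φ α) s f)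
    (hδ : 0 < δ) (hδ1 : δ < 1)
    (hΓ : (Measure.pi fun _ : Fin n => P).real
        {s | (Γ : ℝ≥0∞) < gammaFunctional 2 (fun f g : F => empDist s f g)} ≤ δ / 8)
    {b B : ℝ} (hb : truncSlope φ F α < b) (hB : max (Γ : ℝ) (diameter (popDist P) F).toReal < B) :
    1 - δ ≤ (Measure.pi fun _ : Fin n => P).real
        {s | risk P (fhat s) - risk P fstar ≤
          48 * b * B * √(Real.log (8 / δ) / n) + 2 * M * σ ^ 2 / α} := by
  set μ := Measure.pi fun _ : Fin n => P with hμ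
  have hn' : (0 : ℝ) < n := by exact_mod_cast hn
  have hb0 : 0 < b := (hφ.truncSlope_nonneg hα hF0).trans_lt hb
  have hB0 : 0 < B := (le_max_of_le_left Γ.2).trans_lt hB
  have hd := diameter_popDist_lt_top hσ.le hm h2
  have hlip : ∀ f ∈ F, ∀ g ∈ F, ∀ z, |φ α (f z) - φ α (g z)| ≤ b * |f z - g z| :=
    fun f hf g hg z => hφ.abs_sub_le_mul hα (hF0 f hf z) (hF0 g hg z)
      ((hφ.le_truncSlope hα hF0 hf z).trans hb.le) ((hφ.le_truncSlope hα hF0 hg z).trans hb.le)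
  have hmφ : ∀ f ∈ F, Measurable fun z => φ α (f z) := fun f hf =>
    hφ.measurable_comp hα (hF0 f hf) (hm f hf)
  have hint : ∀ f ∈ F, Integrable (fun z => φ α (f z)) P ∧
      |∫ z, φ α (f z) ∂P - risk P f| ≤ M * σ ^ 2 / α := fun f hf =>
    abs_integral_truncation_sub_le hφ hα (hF0 f hf) (hm f hf) (hmφ f hf) (h2 f hf).1 (h2 f hf).2
  set g : (Fin n → 𝒵) → 𝒵 → ℝ := fun s z => φ α (fhat s z) - φ α (fstar z) with hg
  have hgm : Measurable (Function.uncurry g) :=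
    (hφ.measurable_comp (f := fun p : (Fin n → 𝒵) × 𝒵 => fhat p.1 p.2) hα
      (fun p => hF0 _ (hhat p.1).1 p.2) hmeas).sub ((hmφ _ hstar).comp measurable_snd)
  have hdiff : ∀ s, MemLp (fun z => b * (fhat s z - fstar z)) 2 P := fun s =>
    ((memLp_two_of_integrable_sq (hm _ (hhat s).1) (h2 _ (hhat s).1).1).sub
      (memLp_two_of_integrable_sq (hm _ hstar) (h2 _ hstar).1)).const_mul b
  have hgle : ∀ s z, ‖g s z‖ ≤ ‖b * (fhat s z - fstar z)‖ := fun s z => by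
    rw [norm_mul, Real.norm_of_nonneg hb0.le]
    exact hlip _ (hhat s).1 _ hstar z
  have hgL : ∀ s, MemLp (g s) 2 P := fun s =>
    (hdiff s).mono (hgm.comp measurable_prodMk_left).aestronglyMeasurable (ae_of_all _ (hgle s))
  have hgv : ∀ s, ∫ z, g s z ^ 2 ∂P ≤ (b * B) ^ 2 := fun s => by
    calc ∫ z, g s z ^ 2 ∂P ≤ ∫ z, (b * (fhat s z - fstar z)) ^ 2 ∂P :=
          integral_mono (hgL s).integrable_sq (hdiff s).integrable_sq fun z => sq_le_sq.2 (hgle s z)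
      _ = b ^ 2 * ∫ z, (fhat s z - fstar z) ^ 2 ∂P := by
          simp_rw [mul_pow]; rw [integral_const_mul]
      _ ≤ b ^ 2 * (diameter (popDist P) F).toReal ^ 2 := by
          gcongr; exact integral_sq_sub_le_diameter hd (hhat s).1 hstar
      _ ≤ b ^ 2 * B ^ 2 := by gcongr; exact (le_max_right _ _).trans hB.le
      _ = _ := (mul_pow _ _ _).symm
  set L := Real.log (8 / δ) with hL
  have hL1 : 1 ≤ L := by
    rw [hL, Real.le_log_iff_exp_le (by positivity)]
    have h8 : (8 : ℝ) ≤ 8 / δ := by rw [le_div_iff₀ hδ]; linarith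
    linarith [Real.exp_one_lt_d9]
  have hsL : 1 ≤ √L := Real.one_le_sqrt.2 hL1
  -- Chosen so that `n * t` is twice the chaining threshold `6 * (u * (b * √n) * B)` with `u = 2 *
  -- √L`, the value for which `u ^ 2 = -(4 * log p)` at `p = δ / 8`.
  set t := 24 * b * B * √(L / n) with ht
  have ht0 : 0 < t := by positivity
  have hnt : n * t = 2 * (6 * (2 * √L * (b * √n) * B)) := by
    have : (n : ℝ) * √(L / n) = √L * √n := by
      rw [Real.sqrt_div (by linarith)]
      nth_rewrite 1 [← Real.mul_self_sqrt hn'.le]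
      field_simp
    rw [ht]
    linear_combination (24 * b * B) * this
  have hvt : 2 * (b * B) ^ 2 ≤ n * t ^ 2 := by
    have : n * t ^ 2 = 576 * (b * B) ^ 2 * L := by
      rw [ht, mul_pow, Real.sq_sqrt (by positivity)]; field_simp; norm_num
    rw [this]
    nlinarith [sq_nonneg (b * B)]
  have hup : (2 * √L) ^ 2 = -(4 * Real.log (δ / 8)) := by
    rw [mul_pow, Real.sq_sqrt (by linarith), hL, ← inv_div δ 8, Real.log_inv]; ring
  have hμN : μ {s | (Γ : ℝ≥0∞) < gammaFunctional 2 (fun f g : F => empDist s f g)} ≤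
      ENNReal.ofReal (δ / 8) := by
    rw [← ofReal_measureReal]; exact ENNReal.ofReal_le_ofReal hΓ
  have hΓB : (Γ : ℝ) < B := (le_max_left (Γ : ℝ) _).trans_lt hB
  have hγ : ∀ s : Fin n → 𝒵, s ∉ {s : Fin n → 𝒵 | (Γ : ℝ≥0∞) <
      gammaFunctional 2 (fun f g : F => empDist s f g)} →
      gammaFunctional 2 (fun f g : F => empDist s f g) < ENNReal.ofReal B := fun s hs => by
    rw [mem_ofPred_eq, not_lt] at hs
    refine hs.trans_lt ?_
    rw [← ENNReal.ofReal_coe_nnreal]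
    exact (ENNReal.ofReal_lt_ofReal_iff hB0).2 hΓB
  have hdev := measure_deviation_le P hn hgm ht0 hgL hgv hvt
    {s | (Γ : ℝ≥0∞) < gammaFunctional 2 (fun f g : F => empDist s f g)}
    (p := ENNReal.ofReal (δ / 4)) fun s s' hs hs' S hS => by
      have hcard := card_symmetrized_le (ψ := φ α) (u := 2 * √L) (f := fhat) (f₀ := fstar) hn hb0.le
        hlip hB0.le (hγ s hs) (hγ s' hs') (p := δ / 8) (by positivity) (by linarith) (by linarith)
        hup (fun r => (hhat r).1) hstar S (by rw [← hnt]; exact hS)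
      rw [show 2 * (δ / 8) = δ / 4 by ring] at hcard
      have := ENNReal.ofReal_le_ofReal hcard
      rwa [ENNReal.ofReal_natCast, ENNReal.ofReal_mul (by positivity), ENNReal.ofReal_pow (by norm_num),
        ENNReal.ofReal_ofNat] at this
  -- The exceptional sets of the two samples cost `δ / 8` each and the sign patterns `2 * (δ / 8)`;
  -- Chebyshev's inequality doubles the total to `δ`.
  have hδbound : μ {s | 2 * (n * t) < n * (∫ z, g s z ∂P) - ∑ i, g s (s i)} ≤ ENNReal.ofReal δ := by
    calc _ ≤ _ := hdev
      _ ≤ 2 * (2 * ENNReal.ofReal (δ / 8) + ENNReal.ofReal (δ / 4)) := by gcongr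
      _ = ENNReal.ofReal (2 * (2 * (δ / 8) + δ / 4)) := by
        rw [ENNReal.ofReal_mul (by norm_num), ENNReal.ofReal_add (by positivity) (by positivity),
          ENNReal.ofReal_mul (by norm_num), ENNReal.ofReal_ofNat]
      _ = ENNReal.ofReal δ := by congr 1; ring
  have hδreal : μ.real {s | 2 * (n * t) < n * (∫ z, g s z ∂P) - ∑ i, g s (s i)} ≤ δ :=
    ENNReal.toReal_le_of_le_ofReal hδ.le hδbound
  set R := {s | risk P (fhat s) - risk P fstar ≤
    48 * b * B * √(L / n) + 2 * M * σ ^ 2 / α} with hR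
  have hcover : univ ⊆ R ∪ {s | 2 * (n * t) < n * (∫ z, g s z ∂P) - ∑ i, g s (s i)} := by
    intro s _
    by_contra hs
    rw [mem_union, not_or] at hs
    have hs1 : ¬ risk P (fhat s) - risk P fstar ≤
      48 * b * B * √(L / n) + 2 * M * σ ^ 2 / α := hs.1
    have hs2 : ¬ 2 * (n * t) < n * (∫ z, g s z ∂P) - ∑ i, g s (s i) := hs.2
    -- Minimality of `fhat s` enters here.
    have hemp : ∑ i, g s (s i) ≤ 0 := by
      have := (hhat s).2 _ hstar
      unfold empTruncRisk at this
      rw [mul_le_mul_iff_right₀ (by positivity)] at this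
      simp only [hg, Finset.sum_sub_distrib]
      linarith
    have hgint : ∫ z, g s z ∂P = ∫ z, φ α (fhat s z) ∂P - ∫ z, φ α (fstar z) ∂P :=
      integral_sub (hint _ (hhat s).1).1 (hint _ hstar).1
    have hle : ∫ z, g s z ∂P ≤ 2 * t := by
      have : n * (∫ z, g s z ∂P) ≤ n * (2 * t) := by linarith
      exact le_of_mul_le_mul_left this hn'
    have h1 := abs_le.1 (hint _ (hhat s).1).2
    have h2 := abs_le.1 (hint _ hstar).2
    refine hs1 ?_
    rw [show 2 * M * σ ^ 2 / α = 2 * (M * σ ^ 2 / α) by ring,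
      show 48 * b * B * √(L / n) = 2 * t by rw [ht]; ring]
    linarith [h1.1, h2.2]
  have htot : (1 : ℝ) ≤ μ.real R +
      μ.real {s | 2 * (n * t) < n * (∫ z, g s z ∂P) - ∑ i, g s (s i)} := by
    rw [← probReal_univ (μ := μ)]
    exact (measureReal_mono hcover).trans (measureReal_union_le _ _)
  linarith

/-- The strict bounds `b > β` and `B > D` made the deviation level positive and allowed a
near-optimal admissible sequence. They are removed by letting both excesses `1 / (k + 1)` tend to
`0`, using right continuity of the distribution function of the excess risk. -/
theorem excess_risk_le (hF0 : ∀ f ∈ F, ∀ z, 0 ≤ f z) (hm : ∀ f ∈ F, Measurable f)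
    (hσ : 0 < σ) (h2 : ∀ f ∈ F, Integrable (fun z => f z ^ 2) P ∧ ∫ z, f z ^ 2 ∂P ≤ σ ^ 2)
    (hφ : IsTruncation φ M) (hα : 0 < α) (hstar : fstar ∈ F) (hn : 0 < n)
    (hmeas : Measurable (fun p : (Fin n → 𝒵) × 𝒵 => fhat p.1 p.2))
    (hhat : ∀ s, fhat s ∈ F ∧ ∀ f ∈ F, empTruncRisk (φ α) s (fhat s) ≤ empTruncRisk (φ α) s f)
    (hδ : 0 < δ) (hδ1 : δ < 1)
    (hΓ : (Measure.pi fun _ : Fin n => P).real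
        {s | (Γ : ℝ≥0∞) < gammaFunctional 2 (fun f g : F => empDist s f g)} ≤ δ / 8) :
    1 - δ ≤ (Measure.pi fun _ : Fin n => P).real
        {s | risk P (fhat s) - risk P fstar ≤
          48 * truncSlope φ F α * max (Γ : ℝ) (diameter (popDist P) F).toReal *
            √(Real.log (8 / δ) / n) + 2 * M * σ ^ 2 / α} := by
  set β := truncSlope φ F α
  set D := max (Γ : ℝ) (diameter (popDist P) F).toReal with hD
  have hβ : 0 ≤ β := hφ.truncSlope_nonneg hα hF0
  have hD0 : 0 ≤ D := le_max_of_le_left Γ.2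
  have hX : Measurable fun s => risk P (fhat s) - risk P fstar :=
    (hmeas.stronglyMeasurable.integral_prod_right (ν := P)).measurable.sub_const _
  have hinv : Antitone fun k : ℕ => 1 / ((k : ℝ) + 1) := fun i j hij =>
    one_div_le_one_div_of_le (by positivity) (by simpa using hij)
  refine le_measureReal_of_tendsto _ hX (τ := fun k : ℕ =>
    48 * (β + 1 / ((k : ℝ) + 1)) * (D + 1 / ((k : ℝ) + 1)) * √(Real.log (8 / δ) / n) +
      2 * M * σ ^ 2 / α) ?_ ?_ fun k => ?_
  · intro i j hij
    have h1 := hinv hij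
    have h0 : (0 : ℝ) ≤ 1 / ((j : ℝ) + 1) := by positivity
    simp only at h1
    simp only
    gcongr
  · have h1 : Tendsto (fun k : ℕ => 1 / ((k : ℝ) + 1)) atTop (𝓝 0) :=
      tendsto_one_div_add_atTop_nhds_zero_nat
    have h := ((((h1.const_add β).const_mul 48).mul (h1.const_add D)).mul_const
      (√(Real.log (8 / δ) / n))).add_const (2 * M * σ ^ 2 / α)
    simpa using h
  · exact excess_risk_le_of_lt hF0 hm hσ h2 hφ hα hstar hn hmeas hhat hδ hδ1 hΓ
      (lt_add_of_pos_right _ (by positivity)) (lt_add_of_pos_right _ (by positivity))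

end ExcessRisk

theorem theorem2 :
    -- a universal constant
    ∃ C : ℝ, 0 < C ∧
    ∀ (𝒳 𝒴 : Type*) [MeasurableSpace 𝒳] [MeasurableSpace 𝒴]
      -- the distribution of `Z = (X, Y)`, the hypotheses, the loss, the class `F`
      (P : Measure (𝒳 × 𝒴)) [IsProbabilityMeasure P]
      (H : Set (𝒳 → 𝒴)) (ℓ : 𝒴 → 𝒴 → ℝ) (_ : ∀ y y', 0 ≤ ℓ y y')
      (F : Set (𝒳 × 𝒴 → ℝ)) (_ : F = lossClass ℓ H)
      (_ : ∀ f ∈ F, Measurable f)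
      -- the second moment assumption
      (σ : ℝ) (_ : 0 < σ)
      (_ : ∀ f ∈ F, Integrable (fun z => f z ^ 2) P ∧ ∫ z, f z ^ 2 ∂P ≤ σ ^ 2)
      -- the truncation functions
      (φ : ℝ → ℝ → ℝ) (M : ℝ) (_ : IsTruncation φ M) (α : ℝ) (_ : 0 < α)
      -- a minimizer of the risk over `F`
      (fstar : 𝒳 × 𝒴 → ℝ) (_ : fstar ∈ F) (_ : ∀ f ∈ F, risk P fstar ≤ risk P f)
      -- the minimizer of the empirical truncated risk over `F`, a measurable function of the sample
      (n : ℕ) (_ : 0 < n)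
      (fhat : (Fin n → 𝒳 × 𝒴) → (𝒳 × 𝒴 → ℝ))
      (_ : Measurable (fun p : (Fin n → 𝒳 × 𝒴) × (𝒳 × 𝒴) => fhat p.1 p.2))
      (_ : ∀ s, fhat s ∈ F ∧ ∀ f ∈ F, empTruncRisk (φ α) s (fhat s) ≤ empTruncRisk (φ α) s f)
      -- the confidence parameter and the complexity bound
      (δ : ℝ) (_ : 0 < δ) (_ : δ < 1) (Γ : ℝ≥0)
      (_ : (Measure.pi fun _ : Fin n => P).real
        {s | (Γ : ℝ≥0∞) < gammaFunctional 2 (fun f g : F => empDist s f g)} ≤ δ / 8),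
      -- the properties of `β(F, ·)`
      (∀ a, 0 < a → 0 ≤ truncSlope φ F a ∧ truncSlope φ F a ≤ 1 ∧
        ((∃ f ∈ F, ∃ z, halfDeriv (φ a) (f z) ≠ 0) → 0 < truncSlope φ F a)) ∧
      MonotoneOn (truncSlope φ F) (Ioi 0) ∧
      -- the population diameter is finite, and the excess risk bound holds
      diameter (popDist P) F < ⊤ ∧
      1 - 3 * δ ≤ (Measure.pi fun _ : Fin n => P).real
        {s | risk P (fhat s) - risk P fstar ≤
          C * truncSlope φ F α * max (Γ : ℝ) (diameter (popDist P) F).toReal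
            * √(Real.log (8 / δ) / n) + 2 * M * σ ^ 2 / α} := by
  refine ⟨48, by norm_num, ?_⟩
  intro 𝒳 𝒴 _ _ P _ H ℓ hℓ F hF hm σ hσ h2 φ M hφ α hα fstar hstar _ n hn fhat hmeas hhat δ hδ hδ1
    Γ hΓ
  have hF0 : ∀ f ∈ F, ∀ z, 0 ≤ f z := by
    subst hF
    rintro _ ⟨h, _, rfl⟩ z
    exact hℓ _ _
  refine ⟨fun a ha => ⟨hφ.truncSlope_nonneg ha hF0, hφ.truncSlope_le_one ha hF0, ?_⟩,
    hφ.truncSlope_mono hF0, diameter_popDist_lt_top hσ.le hm h2, ?_⟩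
  · rintro ⟨f, hf, z, hne⟩
    exact (lt_of_le_of_ne (hφ.halfDeriv_nonneg ha (hF0 f hf z)) hne.symm).trans_le
      (hφ.le_truncSlope ha hF0 hf z)
  -- The bound holds with probability at least `1 - δ`, which exceeds `1 - 3 * δ`.
  · have := excess_risk_le hF0 hm hσ h2 hφ hα hstar hn hmeas hhat hδ hδ1 hΓ
    linarith
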